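/- **Corollary 1.7.** For a (possibly non-unital) C\*-algebra $A$ let $\mathfrak S(A)\subset A^*$ denote its state space (positive linear functionals of norm $1$); a *pure state* of $A$ is an extreme point of $\mathfrak S(A)$. Let $\mathcal F$ be a unital C\*-algebra and $\mathfrak S_0\subseteq\mathfrak S(\mathcal F)$ a set of states. Let $\mathcal L$ be an *ideal host* for the pair $(\mathcal F,\mathfrak S_0)$, that is, a C\*-algebra $\mathcal L$ faithfully embedded as a closed two-sided ideal (in particular, as a hereditary C\*-subalgebra) in a unital C\*-algebra $\mathcal E$, together with a unital $*$-homomorphism $\xi:\mathcal F\to\mathcal E$, such that $\mathcal E$ is generated as a C\*-algebra by $\mathcal L\cup\xi(\mathcal F)$ and such that the map $$\theta:\mathfrak S(\mathcal L)\to\mathfrak S(\mathcal F),\qquad \theta(\omega):=\widehat\omega\circ\xi,$$ is injective with range $\theta(\mathfrak S(\mathcal L))=\mathfrak S_0$, where $\widehat\omega$ is the unique state of $\mathcal E$ that extends $\omega$ (equivalently, $\theta(\omega)(F)=\lim_\alpha\omega\big(E_\alpha\,\xi(F)\,E_\alpha\big)$ for $F\in\mathcal F$ and any approximate identity $\{E_\alpha\}$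 of $\mathcal L$). Then $\theta$ maps every pure state of $\mathcal L$ to a pure state of $\mathcal F$. Moreover, every extreme point of $\mathfrak S_0$ is a pure state of $\mathcal F$. -/

import Mathlib

open scoped ComplexOrder

noncomputable section

/-- The state space of a (possibly non-unital) C⋆-algebra: positive linear functionals of norm one,
as a subset of the dual Banach space. -/
def stateSpace (A : Type*) [NonUnitalCStarAlgebra A] [PartialOrder A] : Set (StrongDual ℂ A) :=
  {φ | (∀ a : A, 0 ≤ a → 0 ≤ φ a) ∧ ‖φ‖ = 1}

/-- The pure states: the extreme points of the state space. -/
def pureStates (A : Type*) [NonUnitalCStarAlgebra A] [PartialOrder A] : Set (StrongDual ℂ A) :=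
  (stateSpace A).extremePoints ℝ

/-- The copy `ι(L)` of `L` is hereditary in `E`: if `0 ≤ a ≤ b` with `a ∈ E` and `b ∈ ι(L)`,
then `a ∈ ι(L)`. -/
def IsHereditary {L E : Type*} [NonUnitalCStarAlgebra L] [CStarAlgebra E] [PartialOrder E]
    (ι : L →⋆ₙₐ[ℂ] E) : Prop :=
  ∀ (a : E) (b : L), 0 ≤ a → a ≤ ι b → a ∈ Set.range ι

/-- The copy `ι(L)` of `L` is a two-sided ideal of `E`. -/
def IsTwoSidedIdeal {L E : Type*} [NonUnitalCStarAlgebra L] [CStarAlgebra E]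
    (ι : L →⋆ₙₐ[ℂ] E) : Prop :=
  ∀ (x : E) (b : L), x * ι b ∈ Set.range ι ∧ ι b * x ∈ Set.range ι

section StateExtension

open Filter Topology

theorem mul_self_le_self_of_le_one {A : Type*} [CStarAlgebra A] [PartialOrder A]
    [StarOrderedRing A] {a : A} (h0 : 0 ≤ a) (h1 : a ≤ 1) : a * a ≤ a := by
  have := CStarAlgebra.pow_antitone h0 h1 one_le_two
  simpa [sq] using this

theorem stateSpace_re_star_mul_self_le {A : Type*} [NonUnitalCStarAlgebra A]
    [PartialOrder A] {φ : StrongDual ℂ A} (hφ : φ ∈ stateSpace A) (a : A) :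
    (φ (star a * a)).re ≤ ‖a‖ ^ 2 := by
  calc (φ (star a * a)).re ≤ ‖φ (star a * a)‖ := Complex.re_le_norm _
    _ ≤ ‖φ‖ * ‖star a * a‖ := φ.le_opNorm _
    _ = ‖a‖ ^ 2 := by rw [hφ.2, one_mul, CStarRing.norm_star_mul_self, sq]

section General

variable {A : Type*} [NonUnitalCStarAlgebra A] [PartialOrder A] [StarOrderedRing A]

theorem stateSpace_cauchySchwarz {φ : StrongDual ℂ A} (hφ : φ ∈ stateSpace A) (a b : A) :
    ‖φ (star a * b)‖ ^ 2 ≤ (φ (star a * a)).re * (φ (star b * b)).re := by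
  let f : A →ₚ[ℂ] ℂ := PositiveLinearMap.mk₀ φ.toLinearMap hφ.1
  have h := norm_inner_le_norm (𝕜 := ℂ) (f.toPreGNS a) (f.toPreGNS b)
  have ha : ‖f.toPreGNS a‖ ^ 2 = (φ (star a * a)).re := by
    have := f.preGNS_norm_sq (f.toPreGNS a)
    have := congrArg Complex.re this
    rw [← Complex.ofReal_pow, Complex.ofReal_re] at this
    exact this
  have hb : ‖f.toPreGNS b‖ ^ 2 = (φ (star b * b)).re := by
    have := f.preGNS_norm_sq (f.toPreGNS b)
    have := congrArg Complex.re this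
    rw [← Complex.ofReal_pow, Complex.ofReal_re] at this
    exact this
  rw [← ha, ← hb, ← mul_pow]
  rw [PositiveLinearMap.preGNS_inner_def] at h
  have h' : ‖φ (star a * b)‖ ≤ ‖f.toPreGNS a‖ * ‖f.toPreGNS b‖ := h
  gcongr

theorem stateSpace_tendsto_approximateUnit {φ : StrongDual ℂ A} (hφ : φ ∈ stateSpace A)
    {l : Filter A} (hl : l.IsIncreasingApproximateUnit) :
    Tendsto (fun e => (φ e).re) l (𝓝 1) := by
  rw [Metric.tendsto_nhds]
  intro ε hε
  obtain ⟨δ, hδ0, hδ1, hδε⟩ : ∃ δ : ℝ, 0 < δ ∧ δ < 1 ∧ 2 * δ ≤ ε :=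
    ⟨min (1 / 2) (ε / 2), by positivity, by
      have := min_le_left (1 / 2) (ε / 2); linarith, by
      have := min_le_right (1 / 2) (ε / 2); linarith⟩
  obtain ⟨x, hx1, hx⟩ : ∃ x : A, ‖x‖ < 1 ∧ 1 - δ < ‖φ x‖ :=
    φ.exists_lt_apply_of_lt_opNorm (by rw [hφ.2]; linarith)
  have ht : Tendsto (fun e => ‖φ (e * x)‖) l (𝓝 ‖φ x‖) :=
    ((φ.continuous.tendsto _).comp (hl.tendsto_mul_right x)).norm
  filter_upwards [ht.eventually_const_lt hx, hl.eventually_nonneg, hl.eventually_norm]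
    with e he he0 he1
  have hsa : star e = e := (IsSelfAdjoint.of_nonneg he0).star_eq
  have hcs := stateSpace_cauchySchwarz hφ e x
  have hxx : (φ (star x * x)).re ≤ 1 := (stateSpace_re_star_mul_self_le hφ x).trans (by
    nlinarith [norm_nonneg x])
  have hee0 : 0 ≤ (φ (star e * e)).re :=
    (Complex.le_def.mp (hφ.1 _ (star_mul_self_nonneg e))).1
  rw [hsa] at hcs hee0
  have hle : (φ (e * e)).re ≤ (φ e).re := by
    have h1 : e * e ≤ e := by
      rw [← Unitization.inr_le_iff _ _
        (by rw [isSelfAdjoint_iff, star_mul, hsa]) (IsSelfAdjoint.of_nonneg he0)]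
      have h0' : (0 : Unitization ℂ A) ≤ (e : Unitization ℂ A) :=
        Unitization.inr_nonneg_iff.mpr he0
      have h1' : (e : Unitization ℂ A) ≤ 1 := by
        rw [← CStarAlgebra.norm_le_one_iff_of_nonneg _ h0', Unitization.norm_inr]
        exact he1
      have := mul_self_le_self_of_le_one h0' h1'
      rwa [← Unitization.inr_mul] at this
    have h2 := hφ.1 _ (sub_nonneg.mpr h1)
    rw [map_sub] at h2
    have := (Complex.le_def.mp h2).1
    simp at this
    linarith
  have hup : (φ e).re ≤ 1 := by
    calc (φ e).re ≤ ‖φ e‖ := Complex.re_le_norm _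
      _ ≤ ‖φ‖ * ‖e‖ := φ.le_opNorm _
      _ ≤ 1 := by rw [hφ.2, one_mul]; exact he1
  have hlow : (1 - δ) ^ 2 < (φ (e * e)).re := by
    have h3 : (1 - δ) ^ 2 < ‖φ (e * x)‖ ^ 2 := by
      have : 0 ≤ 1 - δ := by linarith
      gcongr
    nlinarith
  rw [Real.dist_eq, abs_lt]
  constructor <;> nlinarith

end General

theorem stateSpace_apply_one {A : Type*} [CStarAlgebra A] [PartialOrder A] [StarOrderedRing A]
    {φ : StrongDual ℂ A} (hφ : φ ∈ stateSpace A) : φ 1 = 1 := by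
  have h := stateSpace_tendsto_approximateUnit hφ
    (Filter.IsIncreasingApproximateUnit.pure_one A)
  have h1 : (φ 1).re = 1 := tendsto_nhds_unique (tendsto_pure_nhds _ _) h
  have h2 := (Complex.le_def.mp (hφ.1 1 zero_le_one)).2
  apply Complex.ext
  · simpa using h1
  · simpa using h2.symm

theorem mem_stateSpace_of_apply_one {A : Type*} [CStarAlgebra A] [PartialOrder A]
    [StarOrderedRing A] {φ : StrongDual ℂ A} (hn : ‖φ‖ ≤ 1) (h1 : φ 1 = 1) :
    φ ∈ stateSpace A := by
  have hnt : Nontrivial A := by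
    by_contra h
    rw [not_nontrivial_iff_subsingleton] at h
    rw [Subsingleton.elim (1 : A) 0, map_zero] at h1
    exact zero_ne_one h1
  have hle (x : A) : ‖φ x‖ ≤ ‖x‖ :=
    (φ.le_opNorm x).trans (mul_le_of_le_one_left (norm_nonneg x) hn)
  refine ⟨fun a ha => ?_, le_antisymm hn ?_⟩
  · have hsa := IsSelfAdjoint.of_nonneg ha
    have him : (φ a).im = 0 := by
      have key (t : ℝ) : ((φ a).im + t) ^ 2 ≤ ‖a‖ ^ 2 + t ^ 2 := by
        have e1 : φ (a + ((t : ℂ) * Complex.I) • 1) = φ a + t * Complex.I := by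
          rw [map_add, map_smul, h1, smul_eq_mul, mul_one]
        have e2 : ((φ a).im + t) ^ 2 ≤ ‖φ (a + ((t : ℂ) * Complex.I) • 1)‖ ^ 2 := by
          rw [e1, ← sq_abs]
          have := Complex.abs_im_le_norm (φ a + t * Complex.I)
          simp only [Complex.add_im, Complex.mul_im, Complex.ofReal_re, Complex.I_im, mul_one,
            Complex.ofReal_im, Complex.I_re, mul_zero, add_zero] at this
          gcongr
        have e3 : star (a + ((t : ℂ) * Complex.I) • (1 : A)) * (a + ((t : ℂ) * Complex.I) • 1)
            = a * a + ((t : ℂ) ^ 2) • 1 := by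
          rw [star_add, hsa.star_eq, star_smul, star_one]
          simp only [Complex.star_def, map_mul, Complex.conj_ofReal, Complex.conj_I, mul_add,
            add_mul, mul_smul_comm, smul_mul_assoc, mul_one, one_mul]
          have e4 : (t : ℂ) * Complex.I * (t * -Complex.I) = t ^ 2 := by
            linear_combination (-(t : ℂ) ^ 2) * Complex.I_mul_I
          rw [smul_add, smul_smul, e4, mul_neg, neg_smul]
          abel
        calc _ ≤ _ := e2
          _ ≤ ‖a + ((t : ℂ) * Complex.I) • 1‖ ^ 2 := by gcongr; exact hle _
          _ = ‖a * a + ((t : ℂ) ^ 2) • 1‖ := by rw [sq, ← CStarRing.norm_star_mul_self, e3]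
          _ ≤ ‖a * a‖ + ‖((t : ℂ) ^ 2) • (1 : A)‖ := norm_add_le _ _
          _ ≤ ‖a‖ ^ 2 + t ^ 2 := by
            gcongr
            · rw [sq]; exact norm_mul_le _ _
            · rw [norm_smul, CStarRing.norm_one, mul_one, norm_pow, Complex.norm_real,
                Real.norm_eq_abs, sq_abs]
      by_contra hne
      have := key ((‖a‖ ^ 2 + 1) / (2 * (φ a).im))
      have e : 2 * (φ a).im * ((‖a‖ ^ 2 + 1) / (2 * (φ a).im)) = ‖a‖ ^ 2 + 1 := by
        field_simp
      nlinarith [sq_nonneg (φ a).im]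
    have hre : 0 ≤ (φ a).re := by
      have e1 : ‖algebraMap ℝ A ‖a‖ - a‖ ≤ ‖a‖ := by
        have h0 : 0 ≤ algebraMap ℝ A ‖a‖ - a :=
          sub_nonneg.mpr hsa.le_algebraMap_norm_self
        refine (CStarAlgebra.norm_le_norm_of_nonneg_of_le h0 (sub_le_self _ ha)).trans ?_
        rw [norm_algebraMap', norm_norm]
      have e2 : φ (algebraMap ℝ A ‖a‖ - a) = (‖a‖ : ℂ) - φ a := by
        have : algebraMap ℝ A ‖a‖ = (‖a‖ : ℂ) • (1 : A) := by
          rw [Algebra.algebraMap_eq_smul_one]; exact (Complex.coe_smul _ _).symm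
        rw [map_sub, this, map_smul, h1, smul_eq_mul, mul_one]
      have e3 := (Complex.re_le_norm _).trans ((hle _).trans e1)
      rw [e2] at e3
      simp at e3
      linarith
    rw [Complex.le_def]
    exact ⟨by simpa using hre, by simpa using him.symm⟩
  · have := φ.le_opNorm 1
    rwa [h1, CStarRing.norm_one, CStarRing.norm_one, mul_one] at this

variable {L E : Type*} [NonUnitalCStarAlgebra L] [PartialOrder L] [StarOrderedRing L]
  [CStarAlgebra E] [PartialOrder E] [StarOrderedRing E]

theorem exists_state_extension (ι : L →⋆ₙₐ[ℂ] E) (hι : Function.Injective ι)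
    {ω : StrongDual ℂ L} (hω : ω ∈ stateSpace L) :
    ∃ ψ : StrongDual ℂ E, ψ ∈ stateSpace E ∧ ∀ b : L, ψ (ι b) = ω b := by
  let j : L →ₗᵢ[ℂ] E :=
    { toFun := ι, map_add' := map_add ι, map_smul' := map_smul ι,
      norm_map' := NonUnitalStarAlgHom.norm_map ι hι }
  let g : StrongDual ℂ (LinearMap.range j.toLinearMap) :=
    ω.comp (j.equivRange.symm.toContinuousLinearEquiv : _ →L[ℂ] L)
  have hg (b : L) : g (j.equivRange b) = ω b := by simp [g]
  obtain ⟨ψ, hψ, hn⟩ := exists_extension_norm_eq _ g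
  have hext (b : L) : ψ (ι b) = ω b := by
    rw [← hg, ← hψ]; rfl
  have hn1 : ‖ψ‖ ≤ 1 := by
    rw [hn]
    refine ContinuousLinearMap.opNorm_le_bound _ zero_le_one fun x => ?_
    obtain ⟨b, rfl⟩ := j.equivRange.surjective x
    rw [hg, LinearIsometryEquiv.norm_map, ← hω.2]
    exact ω.le_opNorm b
  refine ⟨ψ, mem_stateSpace_of_apply_one hn1 ?_, hext⟩
  have hnt : Nontrivial E := by
    by_contra h
    rw [not_nontrivial_iff_subsingleton] at h
    have : ω = 0 := by
      ext b
      rw [← hext, Subsingleton.elim (ι b) 0, map_zero]; rfl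
    have h2 := hω.2
    rw [this, norm_zero] at h2
    exact zero_ne_one h2
  have hl := CStarAlgebra.increasingApproximateUnit L
  have ht := stateSpace_tendsto_approximateUnit hω hl
  have hb : ∀ᶠ e in CStarAlgebra.approximateUnit L, 2 * (ω e).re - (ψ 1).re ≤ 1 := by
    filter_upwards [hl.eventually_nonneg, hl.eventually_norm] with e he0 he1
    have h0 : 0 ≤ ι e := map_nonneg ι he0
    have h1 : ι e ≤ 1 := by
      rw [← CStarAlgebra.norm_le_one_iff_of_nonneg _ h0, NonUnitalStarAlgHom.norm_map ι hι]
      exact he1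
    have h2 : ‖(2 : ℂ) • ι e - 1‖ ≤ 1 := by
      have hsa : IsSelfAdjoint ((2 : ℂ) • ι e - 1) := by
        rw [isSelfAdjoint_iff, star_sub, star_smul, star_one,
          (IsSelfAdjoint.of_nonneg h0).star_eq]
        simp
      have h4 := hsa.norm_mul_self
      have h3 : 0 ≤ ((2 : ℂ) • ι e - 1) * ((2 : ℂ) • ι e - 1) := by
        have := star_mul_self_nonneg ((2 : ℂ) • ι e - 1)
        rwa [hsa.star_eq] at this
      have hsq : ι e * ι e ≤ ι e := mul_self_le_self_of_le_one h0 h1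
      have h5 : ((2 : ℂ) • ι e - 1) * ((2 : ℂ) • ι e - 1) ≤ 1 := by
        have e5 : ((2 : ℂ) • ι e - 1) * ((2 : ℂ) • ι e - 1)
            = 1 - (4 : ℕ) • (ι e - ι e * ι e) := by
          rw [two_smul]; noncomm_ring
        rw [e5]
        exact sub_le_self _ (nsmul_nonneg (sub_nonneg.mpr hsq) 4)
      have h6 := (CStarAlgebra.norm_le_one_iff_of_nonneg _ h3).mpr h5
      rw [h4] at h6
      nlinarith [norm_nonneg ((2 : ℂ) • ι e - 1)]
    have h3 : ‖ψ ((2 : ℂ) • ι e - 1)‖ ≤ 1 :=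
      (ψ.le_opNorm _).trans (mul_le_one₀ hn1 (norm_nonneg _) h2)
    have h4 := (Complex.re_le_norm _).trans h3
    rw [map_sub, map_smul, hext] at h4
    simpa using h4
  have hge : 2 * 1 - (ψ 1).re ≤ 1 :=
    le_of_tendsto ((ht.const_mul 2).sub_const _) hb
  have hle : ‖ψ 1‖ ≤ 1 := by
    have := ψ.le_opNorm 1
    rw [CStarRing.norm_one, mul_one] at this
    exact this.trans hn1
  have hsq := Complex.sq_norm (ψ 1)
  rw [Complex.normSq_apply] at hsq
  have hre : (ψ 1).re ≤ 1 := (Complex.re_le_norm _).trans hle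
  apply Complex.ext
  · simp only [Complex.one_re]; linarith
  · simp only [Complex.one_im]
    nlinarith [norm_nonneg (ψ 1)]

theorem IsHereditary.conj_mem_range {ι : L →⋆ₙₐ[ℂ] E} (hh : IsHereditary ι) {e : L}
    (he : IsSelfAdjoint e) (x : E) : ι e * x * ι e ∈ Set.range ι := by
  have hx : x ∈ Submodule.span ℂ {a : E | 0 ≤ a} := by
    rw [CStarAlgebra.span_nonneg]; trivial
  have hs : star (ι e) = ι e := by rw [← map_star, he.star_eq]
  induction hx using Submodule.span_induction with
  | mem y hy =>
    have h0 : (0 : E) ≤ y := hy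
    refine hh _ ((‖y‖ : ℂ) • (e * e)) ?_ ?_
    · have := star_left_conjugate_nonneg h0 (ι e)
      rwa [hs] at this
    · have h1 : y ≤ algebraMap ℝ E ‖y‖ := (IsSelfAdjoint.of_nonneg h0).le_algebraMap_norm_self
      have h2 := star_left_conjugate_le_conjugate h1 (ι e)
      rw [hs] at h2
      refine h2.trans_eq ?_
      have : algebraMap ℝ E ‖y‖ = (‖y‖ : ℂ) • (1 : E) := by
        rw [Algebra.algebraMap_eq_smul_one]; exact (Complex.coe_smul _ _).symm
      rw [this, map_smul, map_mul]
      simp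
  | zero => exact ⟨0, by simp⟩
  | add y z _ _ hy hz =>
    obtain ⟨b, hb⟩ := hy
    obtain ⟨c, hc⟩ := hz
    exact ⟨b + c, by rw [map_add, hb, hc, mul_add, add_mul]⟩
  | smul k y _ hy =>
    obtain ⟨b, hb⟩ := hy
    exact ⟨k • b, by rw [map_smul, hb, mul_smul_comm, smul_mul_assoc]⟩

theorem tendsto_state_extension (ι : L →⋆ₙₐ[ℂ] E) {ω : StrongDual ℂ L} (hω : ω ∈ stateSpace L)
    {ψ : StrongDual ℂ E} (hψ : ψ ∈ stateSpace E) (hext : ∀ b : L, ψ (ι b) = ω b)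
    {l : Filter L} (hl : l.IsIncreasingApproximateUnit) (x : E) :
    Tendsto (fun e => ψ (ι e * x * ι e)) l (𝓝 (ψ x)) := by
  have ht := stateSpace_tendsto_approximateUnit hω hl
  have ht' : Tendsto (fun e => 2 * ‖x‖ * √(1 - (ω e).re)) l (𝓝 0) := by
    have := ((ht.const_sub 1).sqrt).const_mul (2 * ‖x‖)
    simpa using this
  rw [tendsto_iff_norm_sub_tendsto_zero]
  refine squeeze_zero' (.of_forall fun _ => norm_nonneg _) ?_ ht'
  filter_upwards [hl.eventually_nonneg, hl.eventually_norm] with e he0 he1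
  have h0 : 0 ≤ ι e := map_nonneg ι he0
  have hn : ‖ι e‖ ≤ 1 := (NonUnitalStarAlgHom.norm_apply_le ι e).trans he1
  have h1 : ι e ≤ 1 := (CStarAlgebra.norm_le_one_iff_of_nonneg _ h0).mp hn
  have hs : star (ι e) = ι e := (IsSelfAdjoint.of_nonneg h0).star_eq
  have hs' : star (1 - ι e) = 1 - ι e := by rw [star_sub, star_one, hs]
  have hq : (ψ (star (1 - ι e) * (1 - ι e))).re ≤ 1 - (ω e).re := by
    have h2 : (1 - ι e) * (1 - ι e) ≤ 1 - ι e :=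
      mul_self_le_self_of_le_one (sub_nonneg.mpr h1) (sub_le_self 1 h0)
    have h3 := hψ.1 _ (sub_nonneg.mpr h2)
    rw [map_sub] at h3
    have h4 := (Complex.le_def.mp h3).1
    have h5 : (ψ (1 - ι e)).re = 1 - (ω e).re := by
      rw [map_sub, stateSpace_apply_one hψ, hext]; simp
    rw [Complex.sub_re, h5] at h4
    rw [hs']
    simpa using h4
  have hq0 : 0 ≤ (ψ (star (1 - ι e) * (1 - ι e))).re :=
    (Complex.le_def.mp (hψ.1 _ (star_mul_self_nonneg _))).1
  have hA : ‖ψ ((1 - ι e) * x)‖ ≤ ‖x‖ * √(1 - (ω e).re) := by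
    have h2 := stateSpace_cauchySchwarz hψ (1 - ι e) x
    have h3 := stateSpace_re_star_mul_self_le hψ x
    refine (sq_le_sq₀ (norm_nonneg _) (by positivity)).mp ?_
    rw [mul_pow, Real.sq_sqrt (hq0.trans hq)]
    rw [hs'] at h2 hq hq0
    nlinarith [sq_nonneg ‖x‖]
  have hB : ‖ψ (ι e * x * (1 - ι e))‖ ≤ ‖x‖ * √(1 - (ω e).re) := by
    have h2 := stateSpace_cauchySchwarz hψ (star (ι e * x)) (1 - ι e)
    have h3 := stateSpace_re_star_mul_self_le hψ (star (ι e * x))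
    rw [star_star] at h2 h3
    have h4 : ‖star (ι e * x)‖ ^ 2 ≤ ‖x‖ ^ 2 := by
      rw [norm_star]
      have : ‖ι e * x‖ ≤ ‖x‖ :=
        (norm_mul_le _ _).trans (mul_le_of_le_one_left (norm_nonneg _) hn)
      gcongr
    refine (sq_le_sq₀ (norm_nonneg _) (by positivity)).mp ?_
    rw [mul_pow, Real.sq_sqrt (hq0.trans hq)]
    nlinarith [sq_nonneg ‖x‖]
  have hsplit : ψ (ι e * x * ι e) - ψ x
      = -(ψ ((1 - ι e) * x) + ψ (ι e * x * (1 - ι e))) := by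
    rw [← map_sub, ← map_add, ← map_neg]
    congr 1
    noncomm_ring
  rw [hsplit, norm_neg]
  calc _ ≤ _ := norm_add_le _ _
    _ ≤ _ := by linarith

/-- A state of a hereditary C⋆-subalgebra extends uniquely to a state of the ambient algebra. -/
theorem existsUnique_state_extension (ι : L →⋆ₙₐ[ℂ] E) (hι : Function.Injective ι)
    (hh : IsHereditary ι) {ω : StrongDual ℂ L} (hω : ω ∈ stateSpace L) :
    ∃! ψ : StrongDual ℂ E, ψ ∈ stateSpace E ∧ ∀ b : L, ψ (ι b) = ω b := by
  obtain ⟨ψ, hψ, hext⟩ := exists_state_extension ι hι hω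
  refine ⟨ψ, ⟨hψ, hext⟩, fun χ ⟨hχ, hext'⟩ => ?_⟩
  ext x
  have hl := CStarAlgebra.increasingApproximateUnit L
  refine tendsto_nhds_unique (tendsto_state_extension ι hω hχ hext' hl x) ?_
  refine (tendsto_state_extension ι hω hψ hext hl x).congr' ?_
  filter_upwards [hl.eventually_isSelfAdjoint] with e he
  obtain ⟨b, hb⟩ := hh.conj_mem_range he x
  rw [← hb, hext, hext']

end StateExtension

section Theta

variable {F L E : Type*} [CStarAlgebra F] [PartialOrder F] [StarOrderedRing F]
  [NonUnitalCStarAlgebra L] [PartialOrder L] [StarOrderedRing L]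
  [CStarAlgebra E] [PartialOrder E] [StarOrderedRing E]

/-- The unique state of `E` extending the state `ω` of the hereditary subalgebra `ι(L)`. -/
def stateExtension (ι : L →⋆ₙₐ[ℂ] E) (hι : Function.Injective ι) (hh : IsHereditary ι)
    (ω : stateSpace L) : StrongDual ℂ E :=
  (existsUnique_state_extension ι hι hh ω.2).choose

theorem stateExtension_mem (ι : L →⋆ₙₐ[ℂ] E) (hι : Function.Injective ι) (hh : IsHereditary ι)
    (ω : stateSpace L) : stateExtension ι hι hh ω ∈ stateSpace E :=
  (existsUnique_state_extension ι hι hh ω.2).choose_spec.1.1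

theorem stateExtension_apply (ι : L →⋆ₙₐ[ℂ] E) (hι : Function.Injective ι) (hh : IsHereditary ι)
    (ω : stateSpace L) (b : L) : stateExtension ι hι hh ω (ι b) = ω.1 b :=
  (existsUnique_state_extension ι hι hh ω.2).choose_spec.1.2 b

/-- A unital ⋆-homomorphism of C⋆-algebras as a continuous linear map. -/
def starAlgHomToCLM (ξ : F →⋆ₐ[ℂ] E) : F →L[ℂ] E :=
  LinearMap.mkContinuous (ξ : F →ₗ[ℂ] E) 1 fun f => by
    rw [one_mul]; exact NonUnitalStarAlgHom.norm_apply_le ξ f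

theorem comp_mem_stateSpace (ξ : F →⋆ₐ[ℂ] E) {ψ : StrongDual ℂ E} (hψ : ψ ∈ stateSpace E) :
    ψ.comp (starAlgHomToCLM ξ) ∈ stateSpace F := by
  apply mem_stateSpace_of_apply_one
  · refine (ContinuousLinearMap.opNorm_comp_le _ _).trans ?_
    rw [hψ.2, one_mul]
    exact LinearMap.mkContinuous_norm_le _ zero_le_one _
  · have : (starAlgHomToCLM ξ) 1 = 1 := map_one ξ
    rw [ContinuousLinearMap.comp_apply, this, stateSpace_apply_one hψ]

/-- The map `θ` from the states of `L` to the states of `F`: extend a state of `L` (uniquely)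
to `E`, then pull it back along `ξ : F → E`. -/
def theta (ι : L →⋆ₙₐ[ℂ] E) (ξ : F →⋆ₐ[ℂ] E) (hι : Function.Injective ι) (hh : IsHereditary ι)
    (ω : stateSpace L) : stateSpace F :=
  ⟨(stateExtension ι hι hh ω).comp (starAlgHomToCLM ξ),
    comp_mem_stateSpace ξ (stateExtension_mem ι hι hh ω)⟩

/-- `θ(ω)(f)` is the limit of `ω(e ξ(f) e)` along any approximate identity of `L`
(here `c e` is the element of `L` that corresponds to `e ξ(f) e`). -/
theorem tendsto_theta (ι : L →⋆ₙₐ[ℂ] E) (ξ : F →⋆ₐ[ℂ] E) (hι : Function.Injective ι)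
    (hh : IsHereditary ι) (ω : stateSpace L) {l : Filter L} (hl : l.IsIncreasingApproximateUnit)
    (f : F) (c : L → L) (hc : ∀ᶠ e in l, ι (c e) = ι e * ξ f * ι e) :
    Filter.Tendsto (fun e => ω.1 (c e)) l (nhds ((theta ι ξ hι hh ω).1 f)) := by
  refine (tendsto_state_extension ι ω.2 (stateExtension_mem ι hι hh ω)
    (stateExtension_apply ι hι hh ω) hl (ξ f)).congr' ?_
  filter_upwards [hc] with e he
  rw [← he, stateExtension_apply]

/-- `L`, with the embedding `ι : L → E` and the unital ⋆-homomorphism `ξ : F → E`, is a host for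
the pair `(F, S₀)`. -/
structure IsHost (S₀ : Set (StrongDual ℂ F)) (ι : L →⋆ₙₐ[ℂ] E) (ξ : F →⋆ₐ[ℂ] E) : Prop where
  injective : Function.Injective ι
  hereditary : IsHereditary ι
  generates : (StarAlgebra.adjoin ℂ (Set.range ι ∪ Set.range ξ)).topologicalClosure = ⊤
  theta_injective : Function.Injective (theta ι ξ injective hereditary)
  range_theta : Set.range (fun ω => (theta ι ξ injective hereditary ω : StrongDual ℂ F)) = S₀

/-- A host that is moreover a two-sided ideal of `E`. -/
structure IsIdealHost (S₀ : Set (StrongDual ℂ F)) (ι : L →⋆ₙₐ[ℂ] E) (ξ : F →⋆ₐ[ℂ] E) : Prop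
    extends IsHost S₀ ι ξ where
  ideal : IsTwoSidedIdeal ι

end Theta

end

/-! ### Radon–Nikodym theorem for states, in terms of representations. -/

section RadonNikodym

open scoped InnerProductSpace

variable {F H H' : Type*} [CStarAlgebra F]
  [NormedAddCommGroup H] [InnerProductSpace ℂ H] [CompleteSpace H]
  [NormedAddCommGroup H'] [InnerProductSpace ℂ H'] [CompleteSpace H']

/-! The point is that `θ(𝔖(L))` is a face of the state space of `F`. Suppose `θ(ω)` is a proper
convex combination of states `φ` and `χ`. Then `φ` is dominated by a multiple of `θ(ω)`. Let `π` be
the GNS representation of `E` for the extension of `ω`, with cyclic vector `Ω`. By a Radon–Nikodym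
argument (`exists_vector_of_norm_le`), `φ` is the functional `f ↦ ⟪v, π (ξ f) v⟫` of a unit vector
`v` in the same space.

Because `ι(L)` is an ideal and `ω` has norm one, `π` is nondegenerate on `ι(L)`
(`tendsto_approximateUnit_apply`). So the vector state of `v` on `E` keeps total mass one on `ι(L)`.
It is therefore the extension of a state of `L`, and `θ` sends that state to `φ`.

Both claims follow. An extreme point of a face is extreme in the whole convex set. Since `θ` is
affine and injective, a decomposition of `θ(ω)` inside the face pulls back to a decomposition of
`ω`. -/

theorem inner_starAlgHom_apply_left (π : F →⋆ₐ[ℂ] (H →L[ℂ] H)) (f : F) (x y : H) :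
    ⟪π f x, y⟫_ℂ = ⟪x, π (star f) y⟫_ℂ := by
  rw [map_star, ContinuousLinearMap.star_eq_adjoint, ContinuousLinearMap.adjoint_inner_right]

theorem norm_sq_starAlgHom_apply (π : F →⋆ₐ[ℂ] (H →L[ℂ] H)) (f : F) (x : H) :
    ‖π f x‖ ^ 2 = (⟪x, π (star f * f) x⟫_ℂ).re := by
  rw [map_mul, mul_apply_eq_comp, ← inner_starAlgHom_apply_left]
  exact norm_sq_eq_re_inner (𝕜 := ℂ) _

theorem norm_eq_one_of_inner_self {H : Type*} [NormedAddCommGroup H] [InnerProductSpace ℂ H]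
    {x : H} (hx : ⟪x, x⟫_ℂ = 1) : ‖x‖ = 1 := by
  have h : ‖x‖ ^ 2 = 1 := by
    rw [norm_sq_eq_re_inner (𝕜 := ℂ), hx]; rfl
  exact (pow_eq_one_iff_of_nonneg (norm_nonneg x) two_ne_zero).mp h

/-- A vector `Ω'` whose orbit is dominated by the orbit of `Ω` gives rise to an intertwiner of
the two representations that maps `Ω` to `Ω'`. -/
theorem exists_intertwiner_of_norm_le (π : F →⋆ₐ[ℂ] (H →L[ℂ] H)) (ρ : F →⋆ₐ[ℂ] (H' →L[ℂ] H'))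
    (Ω : H) (Ω' : H') (C : ℝ) (hC : ∀ f, ‖ρ f Ω'‖ ≤ C * ‖π f Ω‖) :
    ∃ V : H →L[ℂ] H', (∀ f x, V (π f x) = ρ f (V x)) ∧ V Ω = Ω' := by
  let e₀ : F →ₗ[ℂ] H :=
    { toFun := fun f => π f Ω
      map_add' := fun f g => by simp
      map_smul' := fun k f => by simp }
  let r : F →ₗ[ℂ] H' :=
    { toFun := fun f => ρ f Ω'
      map_add' := fun f g => by simp
      map_smul' := fun k f => by simp }
  -- `Ω` is not assumed cyclic. The intertwiner is the continuous extension of `π f Ω ↦ ρ f Ω'` to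
  -- the closed orbit space `K`, and zero on `Kᗮ`.
  let K : Submodule ℂ H := (LinearMap.range e₀).topologicalClosure
  have hK (f : F) : π f Ω ∈ K := Submodule.le_topologicalClosure _ ⟨f, rfl⟩
  have hKc : IsClosed (K : Set H) := Submodule.isClosed_topologicalClosure _
  have : CompleteSpace K := hKc.completeSpace_coe
  let e : F →ₗ[ℂ] K := e₀.codRestrict K hK
  have he : DenseRange e := by
    intro x
    rw [closure_subtype]
    have hx : (x : H) ∈ closure (LinearMap.range e₀ : Set H) := x.2
    convert hx using 2
    ext y
    constructor
    · rintro ⟨_, ⟨f, rfl⟩, rfl⟩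
      exact ⟨f, rfl⟩
    · rintro ⟨f, rfl⟩
      exact ⟨e f, ⟨f, rfl⟩, rfl⟩
  let V : H →L[ℂ] H' := (r.extendOfNorm e).comp K.orthogonalProjectionOnto
  have hV (f : F) : V (π f Ω) = ρ f Ω' := by
    have h1 : K.orthogonalProjectionOnto (π f Ω) = e f :=
      K.orthogonalProjectionOnto_mem_subspace_eq_self (e f)
    have h2 : r.extendOfNorm e (e f) = r f := LinearMap.extendOfNorm_eq he ⟨C, hC⟩ f
    rw [ContinuousLinearMap.comp_apply]
    rw [h1, h2]; rfl
  have hV0 (y : H) (hy : y ∈ Kᗮ) : V y = 0 := by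
    have h1 : K.orthogonalProjectionOnto y = 0 :=
      Submodule.orthogonalProjectionOnto_apply_of_mem_orthogonal hy
    rw [ContinuousLinearMap.comp_apply, h1, map_zero]
  have hinv (f : F) (x : H) (hx : x ∈ K) : π f x ∈ K := by
    have : K ≤ K.comap (π f : H →ₗ[ℂ] H) := by
      refine Submodule.topologicalClosure_minimal _ ?_ (hKc.preimage (π f).continuous)
      rintro _ ⟨g, rfl⟩
      have := hK (f * g)
      rwa [map_mul] at this
    exact this hx
  -- `Kᗮ` is invariant too, because `K` is invariant under `π (star f)`; hence extending by zero
  -- preserves the intertwining relation.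
  have hinv' (f : F) (y : H) (hy : y ∈ Kᗮ) : π f y ∈ Kᗮ := by
    rw [Submodule.mem_orthogonal'] at hy ⊢
    intro u hu
    rw [inner_starAlgHom_apply_left]
    exact hy _ (hinv _ _ hu)
  have hVK (f : F) (x : H) (hx : x ∈ K) : V (π f x) = ρ f (V x) := by
    have : K ≤ LinearMap.eqLocus (V.comp (π f) : H →ₗ[ℂ] H') ((ρ f).comp V : H →ₗ[ℂ] H') := by
      refine Submodule.topologicalClosure_minimal _ ?_
        (isClosed_eq (V.comp (π f)).continuous ((ρ f).comp V).continuous)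
      rintro _ ⟨g, rfl⟩
      have h1 := hV (f * g)
      rw [map_mul, map_mul] at h1
      refine h1.trans ?_
      exact congrArg (ρ f) (hV g).symm
    exact this hx
  refine ⟨V, fun f x => ?_, ?_⟩
  · obtain ⟨y, hy, z, hz, rfl⟩ := K.exists_add_mem_mem_orthogonal x
    rw [map_add, map_add, map_add, hVK f y hy, hV0 z hz, hV0 _ (hinv' f z hz), add_zero, add_zero]
  · simpa using hV 1

/-- Radon–Nikodym theorem for vector functionals: a vector functional whose orbit is dominated by
the orbit of `Ω` is a vector functional of the representation of `Ω`. -/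
theorem exists_vector_of_norm_le (π : F →⋆ₐ[ℂ] (H →L[ℂ] H)) (ρ : F →⋆ₐ[ℂ] (H' →L[ℂ] H'))
    (Ω : H) (Ω' : H') (C : ℝ) (hC : ∀ f, ‖ρ f Ω'‖ ≤ C * ‖π f Ω‖) :
    ∃ v : H, ∀ f, ⟪v, π f v⟫_ℂ = ⟪Ω', ρ f Ω'⟫_ℂ := by
  obtain ⟨V, hV, hΩ⟩ := exists_intertwiner_of_norm_le π ρ Ω Ω' C hC
  -- `T` is the Radon–Nikodym derivative: a positive operator in the commutant of `π`. Its square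
  -- root lies there as well, so `T` can be split evenly between the two copies of `Ω`.
  let T : H →L[ℂ] H := V.adjoint.comp V
  have hT : 0 ≤ T := by
    rw [ContinuousLinearMap.nonneg_iff_isPositive]
    exact ContinuousLinearMap.isPositive_adjoint_comp_self V
  have hcomm (f : F) : Commute T (π f) := by
    ext x
    refine ext_inner_right ℂ fun y => ?_
    simp only [T, mul_apply_eq_comp, ContinuousLinearMap.comp_apply]
    rw [ContinuousLinearMap.adjoint_inner_left, inner_starAlgHom_apply_left,
      ContinuousLinearMap.adjoint_inner_left, hV, hV, inner_starAlgHom_apply_left]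
  let R : H →L[ℂ] H := CFC.sqrt T
  have hR : R * R = T := CFC.sqrt_mul_sqrt_self T hT
  have hRs (x y : H) : ⟪R x, y⟫_ℂ = ⟪x, R y⟫_ℂ := by
    have h : IsSelfAdjoint R := IsSelfAdjoint.of_nonneg (CFC.sqrt_nonneg T)
    exact h.isSymmetric x y
  have hRc (f : F) : Commute R (π f) := (hcomm f).cfcₙ_nnreal _
  refine ⟨R Ω, fun f => ?_⟩
  calc ⟪R Ω, π f (R Ω)⟫_ℂ = ⟪R Ω, R (π f Ω)⟫_ℂ := by
        rw [← mul_apply_eq_comp, ← (hRc f).eq, mul_apply_eq_comp]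
    _ = ⟪Ω, T (π f Ω)⟫_ℂ := by rw [hRs, ← hR, mul_apply_eq_comp]
    _ = ⟪Ω', ρ f Ω'⟫_ℂ := by
        rw [ContinuousLinearMap.comp_apply, ContinuousLinearMap.adjoint_inner_right, hV, hΩ]

end RadonNikodym

/-! ### Vector states and the GNS vector. -/

section VectorState

open scoped InnerProductSpace

variable {A H : Type*} [CStarAlgebra A] [PartialOrder A] [StarOrderedRing A]
  [NormedAddCommGroup H] [InnerProductSpace ℂ H] [CompleteSpace H]

/-- The functional `a ↦ ⟪v, π a v⟫`. -/
noncomputable def vectorFunctional (π : A →⋆ₐ[ℂ] (H →L[ℂ] H)) (v : H) : StrongDual ℂ A :=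
  ((innerSL ℂ v).comp (ContinuousLinearMap.apply ℂ H v)).comp (starAlgHomToCLM π)

@[simp]
theorem vectorFunctional_apply (π : A →⋆ₐ[ℂ] (H →L[ℂ] H)) (v : H) (a : A) :
    vectorFunctional π v a = ⟪v, π a v⟫_ℂ := rfl

theorem vectorFunctional_mem_stateSpace (π : A →⋆ₐ[ℂ] (H →L[ℂ] H)) {v : H} (hv : ‖v‖ = 1) :
    vectorFunctional π v ∈ stateSpace A := by
  refine comp_mem_stateSpace π (mem_stateSpace_of_apply_one ?_ ?_)
  · refine ContinuousLinearMap.opNorm_le_bound _ zero_le_one fun T => ?_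
    calc ‖⟪v, T v⟫_ℂ‖ ≤ ‖v‖ * ‖T v‖ := norm_inner_le_norm _ _
      _ ≤ ‖v‖ * (‖T‖ * ‖v‖) := by gcongr; exact T.le_opNorm v
      _ = 1 * ‖T‖ := by rw [hv]; ring
  · change ⟪v, v⟫_ℂ = 1
    rw [inner_self_eq_norm_sq_to_K, hv]; simp

/-- The GNS representation of a positive functional has a cyclic vector that implements the
functional. -/
theorem exists_cyclic_vector_gns (φ : A →ₚ[ℂ] ℂ) :
    ∃ Ω : φ.GNS, DenseRange (fun a => φ.gnsStarAlgHom a Ω) ∧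
      ∀ a, ⟪Ω, φ.gnsStarAlgHom a Ω⟫_ℂ = φ a := by
  have key (a : A) : φ.gnsStarAlgHom a (φ.toPreGNS 1 : φ.GNS) = (φ.toPreGNS a : φ.GNS) := by
    simp
  refine ⟨(φ.toPreGNS 1 : φ.GNS), ?_, fun a => ?_⟩
  · simp_rw [key]
    exact UniformSpace.Completion.denseRange_coe.comp φ.toPreGNS.surjective.denseRange
      (UniformSpace.Completion.continuous_coe _)
  · rw [key, UniformSpace.Completion.inner_coe, PositiveLinearMap.preGNS_inner_def]
    simp

end VectorState

/-! ### States of a non-unital algebra and nondegeneracy on an ideal. -/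

section NonUnital

open Filter Topology
open scoped InnerProductSpace

variable {L E : Type*} [NonUnitalCStarAlgebra L] [PartialOrder L] [StarOrderedRing L]
  [CStarAlgebra E] [PartialOrder E] [StarOrderedRing E]

/-- An approximate unit lies in the unit ball, so its limiting value bounds `‖φ‖` from below. This
replaces the test `φ 1 = 1`. -/
theorem mem_stateSpace_of_tendsto_approximateUnit {L : Type*}
    [NonUnitalCStarAlgebra L] [PartialOrder L] {φ : StrongDual ℂ L}
    (hpos : ∀ a, 0 ≤ a → 0 ≤ φ a) (hn : ‖φ‖ ≤ 1) {l : Filter L}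
    (hl : l.IsIncreasingApproximateUnit) (ht : Tendsto (fun e => (φ e).re) l (𝓝 1)) :
    φ ∈ stateSpace L := by
  have := hl.neBot
  refine ⟨hpos, le_antisymm hn (le_of_tendsto ht ?_)⟩
  filter_upwards [hl.eventually_norm] with e he
  calc (φ e).re ≤ ‖φ e‖ := Complex.re_le_norm _
    _ ≤ ‖φ‖ * ‖e‖ := φ.le_opNorm e
    _ ≤ ‖φ‖ := mul_le_of_le_one_right (norm_nonneg _) he

/-- Norms of functionals are only subadditive, but limits along an approximate unit are additive;
this gives norm exactly one without a unit. -/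
theorem convex_stateSpace : Convex ℝ (stateSpace L) := by
  intro φ hφ χ hχ a b ha hb hab
  have hl := CStarAlgebra.increasingApproximateUnit L
  refine mem_stateSpace_of_tendsto_approximateUnit (fun x hx => ?_) ?_ hl ?_
  · have h1 := smul_nonneg ha (hφ.1 x hx)
    have h2 := smul_nonneg hb (hχ.1 x hx)
    exact add_nonneg h1 h2
  · calc ‖a • φ + b • χ‖ ≤ ‖a • φ‖ + ‖b • χ‖ := norm_add_le _ _
      _ = 1 := by rw [norm_smul, norm_smul, hφ.2, hχ.2, Real.norm_of_nonneg ha,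
        Real.norm_of_nonneg hb, mul_one, mul_one, hab]
  · have h1 := ((stateSpace_tendsto_approximateUnit hφ hl).const_mul a).add
      ((stateSpace_tendsto_approximateUnit hχ hl).const_mul b)
    rw [mul_one, mul_one, hab] at h1
    refine h1.congr fun e => ?_
    simp

variable {H : Type*} [NormedAddCommGroup H] [InnerProductSpace ℂ H] [CompleteSpace H]

/-- If a cyclic vector of a representation of `E` restricts to a state of the ideal `ι(L)`, then
the representation is nondegenerate on `ι(L)`. -/
theorem tendsto_approximateUnit_apply {ι : L →⋆ₙₐ[ℂ] E} (hi : IsTwoSidedIdeal ι)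
    {ω : StrongDual ℂ L} (hω : ω ∈ stateSpace L) (π : E →⋆ₐ[ℂ] (H →L[ℂ] H)) {Ω : H}
    (hd : DenseRange (fun x => π x Ω)) (hΩ : ‖Ω‖ = 1) (hext : ∀ b, ⟪Ω, π (ι b) Ω⟫_ℂ = ω b)
    {l : Filter L} (hl : l.IsIncreasingApproximateUnit) (v : H) :
    Tendsto (fun e => π (ι e) v) l (𝓝 v) := by
  have := hl.neBot
  -- It suffices that `M` is closed and contains the orbit of `Ω`. Closedness is a three-epsilon
  -- argument, using that the operators `π (ι e)` are eventually contractions.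
  let M : Set H := {v | Tendsto (fun e => π (ι e) v) l (𝓝 v)}
  have hle (e : L) (he : ‖e‖ ≤ 1) (x : H) : ‖π (ι e) x‖ ≤ ‖x‖ := by
    have h1 : ‖π (ι e)‖ ≤ 1 := (NonUnitalStarAlgHom.norm_apply_le π (ι e)).trans
      ((NonUnitalStarAlgHom.norm_apply_le ι e).trans he)
    exact ((π (ι e)).le_opNorm x).trans (mul_le_of_le_one_left (norm_nonneg _) h1)
  have hM : IsClosed M := by
    refine isClosed_of_closure_subset fun v hv => ?_
    rw [Set.mem_ofPred_eq, Metric.tendsto_nhds]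
    intro ε hε
    obtain ⟨w, hw, hvw⟩ := Metric.mem_closure_iff.mp hv (ε / 3) (by positivity)
    filter_upwards [Metric.tendsto_nhds.mp hw (ε / 3) (by positivity), hl.eventually_norm]
      with e h1 he
    have h2 : dist (π (ι e) v) (π (ι e) w) < ε / 3 := by
      rw [dist_eq_norm, ← map_sub]
      exact (hle e he _).trans_lt (by rwa [← dist_eq_norm])
    have h3 := dist_triangle4 (π (ι e) v) (π (ι e) w) w v
    rw [dist_comm w v] at h3
    linarith
  have hL (b : L) (x : H) : π (ι b) x ∈ M := by
    have h1 : Tendsto (fun e => starAlgHomToCLM π (ι (e * b)) x) l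
        (𝓝 (starAlgHomToCLM π (ι b) x)) := by
      have hc : Continuous fun c : L => starAlgHomToCLM π (ι c) x := by
        have : Continuous ι := map_continuous ι
        fun_prop
      exact (hc.tendsto b).comp (hl.tendsto_mul_right b)
    refine h1.congr fun e => ?_
    change π (ι (e * b)) x = π (ι e) (π (ι b) x)
    rw [map_mul, map_mul]; rfl
  have hΩM : Tendsto (fun e => π (ι e) Ω) l (𝓝 Ω) := by
    rw [tendsto_iff_norm_sub_tendsto_zero]
    have ht := stateSpace_tendsto_approximateUnit hω hl
    -- The bound comes from `‖π(e)Ω − Ω‖² = ‖π(e)Ω‖² − 2 ω(e) + 1 ≤ 2 (1 − ω(e))`, for self-adjoint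
    -- `e` in the unit ball.
    have ht' : Tendsto (fun e => √(2 * (1 - (ω e).re))) l (𝓝 0) := by
      simpa using ((ht.const_sub 1).const_mul 2).sqrt
    refine squeeze_zero' (.of_forall fun _ => norm_nonneg _) ?_ ht'
    filter_upwards [hl.eventually_norm, hl.eventually_isSelfAdjoint] with e he hs
    refine Real.le_sqrt_of_sq_le ?_
    have h1 := hle e he Ω
    have h2 : RCLike.re ⟪π (ι e) Ω, Ω⟫_ℂ = (ω e).re := by
      rw [inner_starAlgHom_apply_left, ← map_star, hs.star_eq, hext]; rfl
    rw [norm_sub_sq (𝕜 := ℂ), h2, hΩ]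
    rw [hΩ] at h1
    nlinarith [norm_nonneg (π (ι e) Ω)]
  have hxΩ (x : E) : π x Ω ∈ M := by
    have h1 : Tendsto (fun e => π x (π (ι e) Ω)) l (𝓝 (π x Ω)) :=
      ((π x).continuous.tendsto Ω).comp hΩM
    refine hM.mem_of_tendsto h1 (.of_forall fun e => ?_)
    -- The ideal property enters here: `x * ι e` stays in `ι(L)`, so `π x Ω` is a limit of vectors
    -- already known to lie in `M`.
    obtain ⟨b, hb⟩ := (hi x e).1
    have h2 : π x (π (ι e) Ω) = π (ι b) Ω := by rw [hb, map_mul]; rfl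
    rw [h2]
    exact hL b Ω
  have : closure (Set.range fun x => π x Ω) ⊆ M := by
    refine hM.closure_subset_iff.mpr ?_
    rintro _ ⟨x, rfl⟩
    exact hxΩ x
  exact this (hd v)

end NonUnital

/-! ### The range of `θ` as a face. -/

section Theta

open Filter Topology
open scoped InnerProductSpace

variable {F L E : Type*} [CStarAlgebra F] [PartialOrder F] [StarOrderedRing F]
  [NonUnitalCStarAlgebra L] [PartialOrder L] [StarOrderedRing L]
  [CStarAlgebra E] [PartialOrder E] [StarOrderedRing E]
  {H : Type*} [NormedAddCommGroup H] [InnerProductSpace ℂ H] [CompleteSpace H]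

theorem stateExtension_eq {ι : L →⋆ₙₐ[ℂ] E} (hι : Function.Injective ι) (hh : IsHereditary ι)
    (ω : stateSpace L) {ψ : StrongDual ℂ E} (hψ : ψ ∈ stateSpace E)
    (hext : ∀ b, ψ (ι b) = ω.1 b) : stateExtension ι hι hh ω = ψ :=
  (existsUnique_state_extension ι hι hh ω.2).unique
    ⟨stateExtension_mem ι hι hh ω, stateExtension_apply ι hι hh ω⟩ ⟨hψ, hext⟩

/-- A state of `E` that loses no mass on `ι(L)` restricts to a state of `L`. By uniqueness it is the
extension of that restriction. -/
theorem exists_theta_eq_comp {ι : L →⋆ₙₐ[ℂ] E} (ξ : F →⋆ₐ[ℂ] E) (hι : Function.Injective ι)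
    (hh : IsHereditary ι) {ψ : StrongDual ℂ E} (hψ : ψ ∈ stateSpace E) {l : Filter L}
    (hl : l.IsIncreasingApproximateUnit) (ht : Tendsto (fun e => (ψ (ι e)).re) l (𝓝 1)) :
    ∃ ω : stateSpace L, ∀ f, (theta ι ξ hι hh ω).1 f = ψ (ξ f) := by
  let χ : StrongDual ℂ L := LinearMap.mkContinuous
    { toFun := fun b => ψ (ι b)
      map_add' := fun a b => by simp
      map_smul' := fun k a => by simp } 1 fun b => by
        rw [one_mul]
        refine (ψ.le_opNorm _).trans ?_
        rw [hψ.2, one_mul]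
        exact NonUnitalStarAlgHom.norm_apply_le ι b
  have hχ : χ ∈ stateSpace L :=
    mem_stateSpace_of_tendsto_approximateUnit (fun a ha => hψ.1 _ (map_nonneg ι ha))
      (LinearMap.mkContinuous_norm_le _ zero_le_one _) hl ht
  refine ⟨⟨χ, hχ⟩, fun f => ?_⟩
  have := stateExtension_eq hι hh ⟨χ, hχ⟩ hψ fun b => rfl
  change stateExtension ι hι hh ⟨χ, hχ⟩ (ξ f) = ψ (ξ f)
  rw [this]

/-- The same combination of the two extensions is a state extending the combination, so uniqueness
makes the extension, and with it `θ`, affine. -/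
theorem theta_apply_convexCombination (ι : L →⋆ₙₐ[ℂ] E) (ξ : F →⋆ₐ[ℂ] E)
    (hι : Function.Injective ι) (hh : IsHereditary ι) (ω₁ ω₂ : stateSpace L) {a b : ℝ}
    (ha : 0 ≤ a) (hb : 0 ≤ b) (hab : a + b = 1) :
    (theta ι ξ hι hh ⟨a • ω₁.1 + b • ω₂.1, convex_stateSpace ω₁.2 ω₂.2 ha hb hab⟩).1 =
      a • (theta ι ξ hι hh ω₁).1 + b • (theta ι ξ hι hh ω₂).1 := by
  have h := stateExtension_eq hι hh
    ⟨a • ω₁.1 + b • ω₂.1, convex_stateSpace ω₁.2 ω₂.2 ha hb hab⟩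
    (convex_stateSpace (stateExtension_mem ι hι hh ω₁) (stateExtension_mem ι hι hh ω₂) ha hb hab)
    fun c => by simp [stateExtension_apply]
  ext f
  change stateExtension ι hι hh _ (ξ f) = _
  rw [h]
  rfl

/-- A state of `F` dominated by a multiple of a state in the range of `θ` is in the range of `θ`. -/
theorem exists_theta_eq_of_le {ι : L →⋆ₙₐ[ℂ] E} (ξ : F →⋆ₐ[ℂ] E) (hι : Function.Injective ι)
    (hh : IsHereditary ι) (hi : IsTwoSidedIdeal ι) (ω : stateSpace L) {φ : StrongDual ℂ F}
    (hφ : φ ∈ stateSpace F) {c : ℝ} (hc : 0 ≤ c)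
    (hle : ∀ f, (φ (star f * f)).re ≤ c * ((theta ι ξ hι hh ω).1 (star f * f)).re) :
    ∃ ω' : stateSpace L, (theta ι ξ hι hh ω').1 = φ := by
  have hψ := stateExtension_mem ι hι hh ω
  let ψ : E →ₚ[ℂ] ℂ := PositiveLinearMap.mk₀ (stateExtension ι hι hh ω).toLinearMap hψ.1
  let φ' : F →ₚ[ℂ] ℂ := PositiveLinearMap.mk₀ φ.toLinearMap hφ.1
  obtain ⟨Ω, hd, hΩ⟩ := exists_cyclic_vector_gns ψ
  obtain ⟨Ω', -, hΩ'⟩ := exists_cyclic_vector_gns φ'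
  set π := ψ.gnsStarAlgHom
  set ρ := φ'.gnsStarAlgHom
  -- The squared norms are `φ(f⋆f)` and `θ(ω)(f⋆f)`, so domination with constant `c` becomes an
  -- orbit bound with constant `√c`.
  have hdom (f : F) : ‖ρ f Ω'‖ ≤ √c * ‖(π.comp ξ) f Ω‖ := by
    refine (sq_le_sq₀ (norm_nonneg _) (by positivity)).mp ?_
    rw [mul_pow, Real.sq_sqrt hc]
    have h1 : ‖ρ f Ω'‖ ^ 2 = (φ (star f * f)).re := by
      rw [norm_sq_starAlgHom_apply, hΩ']; rfl
    have h2 : ‖(π.comp ξ) f Ω‖ ^ 2 = ((theta ι ξ hι hh ω).1 (star f * f)).re := by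
      rw [norm_sq_starAlgHom_apply, StarAlgHom.comp_apply, hΩ]; rfl
    rw [h1, h2]
    exact hle f
  -- `Ω` is cyclic for `π` on `E`, perhaps not for `π.comp ξ`; still `v` lies in the GNS space of
  -- `E`, where `π` is nondegenerate on `ι(L)`.
  obtain ⟨v, hv⟩ := exists_vector_of_norm_le (π.comp ξ) ρ Ω Ω' _ hdom
  have hvφ (f : F) : ⟪v, π (ξ f) v⟫_ℂ = φ f := (hv f).trans (hΩ' f)
  have hv1 : ‖v‖ = 1 := norm_eq_one_of_inner_self (by
    have := hvφ 1
    rwa [map_one, map_one, stateSpace_apply_one hφ] at this)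
  have hΩ1 : ‖Ω‖ = 1 := norm_eq_one_of_inner_self (by
    have := hΩ 1
    rw [map_one] at this
    exact this.trans (stateSpace_apply_one hψ))
  have hl := CStarAlgebra.increasingApproximateUnit L
  have ht := tendsto_approximateUnit_apply hi ω.2 π hd hΩ1
    (fun b => (hΩ _).trans (stateExtension_apply ι hι hh ω b)) hl v
  obtain ⟨ω', hω'⟩ := exists_theta_eq_comp ξ hι hh (vectorFunctional_mem_stateSpace π hv1) hl (by
    have h1 : Tendsto (fun e => (⟪v, π (ι e) v⟫_ℂ).re) _ (𝓝 (⟪v, v⟫_ℂ).re) :=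
      (Complex.continuous_re.tendsto _).comp (tendsto_const_nhds.inner ht)
    have h2 : (⟪v, v⟫_ℂ).re = 1 := by
      rw [inner_self_eq_norm_sq_to_K, hv1]; simp
    rwa [h2] at h1)
  exact ⟨ω', by ext f; rw [hω' f, vectorFunctional_apply, hvφ]⟩

/-- The range of `θ` is a face of the state space of `F`. -/
theorem exists_theta_eq_of_mem_openSegment {ι : L →⋆ₙₐ[ℂ] E} (ξ : F →⋆ₐ[ℂ] E)
    (hι : Function.Injective ι) (hh : IsHereditary ι) (hi : IsTwoSidedIdeal ι) (ω : stateSpace L)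
    {φ χ : StrongDual ℂ F} (hφ : φ ∈ stateSpace F) (hχ : χ ∈ stateSpace F)
    (h : (theta ι ξ hι hh ω).1 ∈ openSegment ℝ φ χ) :
    ∃ ω' : stateSpace L, (theta ι ξ hι hh ω').1 = φ := by
  obtain ⟨a, b, ha, hb, -, hab⟩ := h
  -- From `θ(ω) = a φ + b χ` and `b χ ≥ 0` on positive elements, `φ ≤ a⁻¹ θ(ω)`.
  refine exists_theta_eq_of_le ξ hι hh hi ω hφ (c := a⁻¹) (by positivity) fun f => ?_
  have h0 : 0 ≤ (χ (star f * f)).re := (Complex.le_def.mp (hχ.1 _ (star_mul_self_nonneg f))).1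
  have h1 : ((theta ι ξ hι hh ω).1 (star f * f)).re
      = a * (φ (star f * f)).re + b * (χ (star f * f)).re := by
    rw [← hab]; simp
  rw [h1, mul_add, inv_mul_cancel_left₀ ha.ne']
  have : 0 ≤ a⁻¹ * (b * (χ (star f * f)).re) := by positivity
  linarith

end Theta

/-! ### Extreme points of the face. -/

theorem corollary1p7 {F L E : Type*}
    [CStarAlgebra F] [PartialOrder F] [StarOrderedRing F]
    [NonUnitalCStarAlgebra L] [PartialOrder L] [StarOrderedRing L]
    [CStarAlgebra E] [PartialOrder E] [StarOrderedRing E]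
    (S₀ : Set (StrongDual ℂ F)) (ι : L →⋆ₙₐ[ℂ] E) (ξ : F →⋆ₐ[ℂ] E)
    (h : IsIdealHost S₀ ι ξ) :
    (∀ ω : stateSpace L, (ω : StrongDual ℂ L) ∈ pureStates L →
      (theta ι ξ h.injective h.hereditary ω : StrongDual ℂ F) ∈ pureStates F) ∧
    S₀.extremePoints ℝ ⊆ pureStates F := by
  have hface (ω : stateSpace L) {φ χ : StrongDual ℂ F} (hφ : φ ∈ stateSpace F)
      (hχ : χ ∈ stateSpace F)
      (hω : (theta ι ξ h.injective h.hereditary ω).1 ∈ openSegment ℝ φ χ) :=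
    exists_theta_eq_of_mem_openSegment ξ h.injective h.hereditary h.ideal ω hφ hχ hω
  have hS : S₀ = Set.range fun ω => (theta ι ξ h.injective h.hereditary ω).1 :=
    h.range_theta.symm
  refine ⟨fun ω hω => ?_, fun φ hφ => ?_⟩
  · refine mem_extremePoints_iff_left.mpr ⟨(theta ι ξ h.injective h.hereditary ω).2,
      fun φ hφ χ hχ hmem => ?_⟩
    obtain ⟨ω₁, hω₁⟩ := hface ω hφ hχ hmem
    -- `hface` treats the first endpoint only; reversing the segment gives the second.
    obtain ⟨ω₂, hω₂⟩ := hface ω hχ hφ (by rwa [openSegment_symm])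
    obtain ⟨a, b, ha, hb, hab, habs⟩ := hmem
    rw [← hω₁, ← hω₂, ← theta_apply_convexCombination ι ξ h.injective h.hereditary ω₁ ω₂ ha.le
      hb.le hab] at habs
    -- Injectivity of `θ` turns the decomposition of `θ(ω)` into one of `ω`, where purity applies.
    have h1 := congrArg Subtype.val (h.theta_injective (Subtype.ext habs))
    have h2 : ω₁.1 = ω.1 :=
      (mem_extremePoints_iff_left.mp hω).2 _ ω₁.2 _ ω₂.2 ⟨a, b, ha, hb, hab, h1⟩
    rw [← hω₁, Subtype.ext h2]
  · obtain ⟨ω, rfl⟩ : φ ∈ Set.range _ := hS ▸ hφ.1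
    refine mem_extremePoints_iff_left.mpr ⟨(theta ι ξ h.injective h.hereditary ω).2,
      fun χ₁ h₁ χ₂ h₂ hmem => ?_⟩
    -- The face property puts both endpoints in `S₀`, where extremality of the given point already
    -- decides the matter.
    have hχ₁ : χ₁ ∈ S₀ := hS ▸ hface ω h₁ h₂ hmem
    have hχ₂ : χ₂ ∈ S₀ := hS ▸ hface ω h₂ h₁ (by rwa [openSegment_symm])
    exact (mem_extremePoints_iff_left.mp hφ).2 _ hχ₁ _ hχ₂ hmem
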